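/- For every integer $N\ge 1$ let $\omega_{2N+1}\subset\mathbb S^2$ be the Swinbank--Purser Fibonacci configuration: the $2N+1$ points $x_i$, $-N\le i\le N$, with longitude $\theta_i=2\pi i\varphi^{-1}$ and latitude $\phi_i\in[-\pi/2,\pi/2]$ given by $\sin\phi_i=\frac{2i}{2N+1}$, where $\varphi=(1+\sqrt5)/2$; that is, $x_i=(\cos\phi_i\cos\theta_i,\ \cos\phi_i\sin\theta_i,\ \sin\phi_i)$. With $|\cdot|$ the Euclidean norm of $\mathbb R^3$, let \[\delta(\omega)=\min_{\substack{x,y\in\omega\\ x\ne y}}|x-y|,\qquad \eta(\omega)=\max_{y\in\mathbb S^2}\min_{x\in\omega}|x-y|\] be the separation and the covering radius of a configuration $\omega\subset\mathbb S^2$. Then the sequence $(\omega_{2N+1})_{N\ge1}$ is quasi-uniform: the mesh ratios $\gamma(\omega_{2N+1})=\eta(\omega_{2N+1})/\delta(\omega_{2N+1})$ are bounded in $N$. Moreover, the separation and the covering radius over the whole sphere, poles included, are both of the order of the number of points to the power $-1/2$: there are constants $c,C>0$ such that for all $N\ge1$ \[\frac{c}{\sqrt{2N+1}}\le\delta(\omega_{2N+1})\le\frac{C}{\sqrt{2N+1}},\qquad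 \frac{c}{\sqrt{2N+1}}\le\eta(\omega_{2N+1})\le\frac{C}{\sqrt{2N+1}}.\] -/

import Mathlib

open scoped Real

noncomputable section

/-- The unit sphere `S²` of Euclidean `ℝ³`. -/
abbrev unitSphere : Set (EuclideanSpace ℝ (Fin 3)) := Metric.sphere 0 1

/-- The point of `S²` with latitude `φ ∈ [-π/2, π/2]` and longitude `θ`. -/
def spherePoint (φ θ : ℝ) : EuclideanSpace ℝ (Fin 3) :=
  !₂[Real.cos φ * Real.cos θ, Real.cos φ * Real.sin θ, Real.sin φ]

/-- The latitude `φ_i ∈ [-π/2, π/2]` with `sin φ_i = 2 i / (2 N + 1)`. -/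
def fibonacciLatitude (N : ℕ) (i : ℤ) : ℝ := Real.arcsin (2 * (i : ℝ) / (2 * (N : ℝ) + 1))

/-- The longitude `θ_i = 2 π i / φ`, where `φ` is the golden ratio. -/
def fibonacciLongitude (i : ℤ) : ℝ := 2 * π * (i : ℝ) * Real.goldenRatio⁻¹

/-- The Swinbank–Purser Fibonacci configuration `ω_{2N+1}`: the points with latitude `φ_i` and
longitude `θ_i` for `-N ≤ i ≤ N`. -/
def fibonacciConfiguration (N : ℕ) : Set (EuclideanSpace ℝ (Fin 3)) :=
  (fun i : ℤ => spherePoint (fibonacciLatitude N i) (fibonacciLongitude i)) ''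
    Set.Icc (-(N : ℤ)) (N : ℤ)

/-- The separation `δ(ω)`: the least distance between two distinct points of `ω`. -/
def separation (ω : Set (EuclideanSpace ℝ (Fin 3))) : ℝ := ω.infsep

/-- The covering radius `η(ω)`: the largest distance from a point `y` of `S²` to `ω`. -/
def coveringRadius (ω : Set (EuclideanSpace ℝ (Fin 3))) : ℝ :=
  ⨆ y : unitSphere, Metric.infDist (y : EuclideanSpace ℝ (Fin 3)) ω

/-- The mesh ratio `γ(ω) = η(ω) / δ(ω)`. -/
def meshRatio (ω : Set (EuclideanSpace ℝ (Fin 3))) : ℝ := coveringRadius ω / separation ω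

/-- A sequence of configurations is quasi-uniform if its mesh ratios are bounded; a configuration
has a mesh ratio if it has at least two points. -/
def IsQuasiUniform (ω : ℕ → Set (EuclideanSpace ℝ (Fin 3))) : Prop :=
  ∃ C : ℝ, ∀ n : ℕ, (ω n).Nontrivial → meshRatio (ω n) ≤ C

theorem spherePoint_mem_unitSphere (φ θ : ℝ) : spherePoint φ θ ∈ unitSphere := by
  have h : (Real.cos φ * Real.cos θ) ^ 2 + (Real.cos φ * Real.sin θ) ^ 2 + Real.sin φ ^ 2 = 1 := by
    linear_combination (Real.cos φ) ^ 2 * Real.sin_sq_add_cos_sq θ + Real.sin_sq_add_cos_sq φ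
  simp [unitSphere, spherePoint, EuclideanSpace.norm_eq, Fin.sum_univ_three, h]

theorem fibonacciConfiguration_subset (N : ℕ) : fibonacciConfiguration N ⊆ unitSphere := by
  rintro _ ⟨i, -, rfl⟩
  exact spherePoint_mem_unitSphere _ _

theorem sin_fibonacciLatitude {N : ℕ} {i : ℤ} (hi : i ∈ Set.Icc (-(N : ℤ)) (N : ℤ)) :
    Real.sin (fibonacciLatitude N i) = 2 * (i : ℝ) / (2 * (N : ℝ) + 1) := by
  have h1 : (-(N : ℝ)) ≤ i := by exact_mod_cast hi.1
  have h2 : (i : ℝ) ≤ N := by exact_mod_cast hi.2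
  have hN : (0 : ℝ) < 2 * (N : ℝ) + 1 := by positivity
  apply Real.sin_arcsin
  · rw [le_div_iff₀ hN]; linarith
  · rw [div_le_iff₀ hN]; linarith

/-- The configuration `ω_{2N+1}` has `2 N + 1` points. -/
theorem ncard_fibonacciConfiguration (N : ℕ) : (fibonacciConfiguration N).ncard = 2 * N + 1 := by
  have hinj : Set.InjOn (fun i : ℤ => spherePoint (fibonacciLatitude N i) (fibonacciLongitude i))
      (Set.Icc (-(N : ℤ)) (N : ℤ)) := by
    intro i hi j hj hij
    have h := congrArg (fun v : EuclideanSpace ℝ (Fin 3) => v 2) hij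
    simp only [spherePoint] at h
    have h' : Real.sin (fibonacciLatitude N i) = Real.sin (fibonacciLatitude N j) := by
      simpa using h
    rw [sin_fibonacciLatitude hi, sin_fibonacciLatitude hj] at h'
    have hN : (2 * (N : ℝ) + 1) ≠ 0 := by positivity
    field_simp at h'
    exact_mod_cast h'
  rw [fibonacciConfiguration, hinj.ncard_image, ← Finset.coe_Icc,
    Set.ncard_coe_finset, Int.card_Icc]
  omega

end

/-!
Write `M = 2 N + 1` and let `r = cos φ` be the horizontal radius of a point of the sphere, so that
`r ^ 2 ≥ 1 / M` on the configuration. The squared distance of two points is the squared chord of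
their latitudes plus `4 r s sin ^ 2` of half the difference of longitudes
(`dist_sq_spherePoint`).

*Separation.* Take two points whose indices differ by `k ≠ 0`. If their radii differ by a factor
of more than two, the difference of the radii is already of order at least `1 / √M`. Otherwise,
unless the points are nearly antipodal, the height difference `2 k / M` forces a squared chord of
order at least `k ^ 2 / (M r) ^ 2`. As `φ⁻¹` is badly approximable
(`one_div_le_abs_mul_inv_goldenRatio_sub`), the longitudinal part is at least of order
`r ^ 2 / k ^ 2`. The product of these two does not depend on `k` or `r`, and the inequality between
the arithmetic and geometric means bounds the squared distance below by a multiple of `1 / M`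
(`one_div_le_meridian_add_parallel`). This is sharp up to a constant, by the two points closest to
the north pole.

*Covering.* Let `y` be a point of the sphere with radius `r`. If `r ≤ 1 / √M`, an endpoint
`x_N` or `x_{-N}` is close to `y`. Otherwise choose a Fibonacci number `q` of order `r √M`. Among `q`
consecutive indices with heights near that of `y`, all latitude chords are of order at most
`q / (M r)`, hence `1 / √M`. Consecutive Fibonacci numbers are coprime and their quotients are good
approximations to `φ⁻¹`, so the corresponding longitudes are dense at scale `1 / q`
(`exists_abs_mul_inv_goldenRatio_sub_le`), and one of the points is at distance at most of order
`r / q`, hence `1 / √M`, along the parallel (`exists_fibonacci_dist_le_of_le_cos`). The bound is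
sharp up to a constant, since the north pole lies on the axis, at distance at least `1 / √M` from
every point of the configuration.
-/

/-! ### Diophantine properties of the golden ratio -/

/-- The inverse golden ratio is badly approximable: the norm `p ^ 2 + p * k - k ^ 2` of
`k * φ⁻¹ - p` in `ℤ[φ]` is a nonzero integer, and the conjugate of `k * φ⁻¹ - p` is `O(|k|)`
unless `k * φ⁻¹ - p` is large. -/
theorem one_div_le_abs_mul_inv_goldenRatio_sub {k : ℤ} (hk : k ≠ 0) (p : ℤ) :
    1 / (3 * |(k : ℝ)|) ≤ |(k : ℝ) * Real.goldenRatio⁻¹ - p| := by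
  have hk1 : (1 : ℝ) ≤ |(k : ℝ)| := by exact_mod_cast Int.one_le_abs hk
  rw [div_le_iff₀ (by positivity)]
  set d := (k : ℝ) * Real.goldenRatio⁻¹ - p with hd
  rcases le_or_gt (1 / 2) |d| with h | h
  · nlinarith
  set e := (k : ℝ) * Real.goldenRatio + p with he
  have hde : d * e = -((p ^ 2 + p * k - k ^ 2 : ℤ) : ℝ) := by
    rw [hd, he, Real.inv_goldenRatio]
    push_cast
    linear_combination (-(k : ℝ) ^ 2) * Real.goldenRatio_mul_goldenConj
      - (k : ℝ) * p * Real.goldenRatio_add_goldenConj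
  have hd0 : d ≠ 0 := by
    have h1 := (Real.goldenRatio_irrational.inv.intCast_mul hk).ne_int p
    rw [hd]
    exact sub_ne_zero.2 h1
  have he0 : e ≠ 0 := by
    have h1 := (Real.goldenRatio_irrational.intCast_mul hk).ne_int (-p)
    intro h2
    apply h1
    push_cast
    linarith
  have h1 : 1 ≤ |d| * |e| := by
    rw [← abs_mul, hde, abs_neg, ← Int.cast_abs]
    have h2 : ((p ^ 2 + p * k - k ^ 2 : ℤ) : ℝ) ≠ 0 := by
      intro h3
      rw [h3, neg_zero] at hde
      exact (mul_ne_zero hd0 he0) hde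
    exact_mod_cast Int.one_le_abs (by exact_mod_cast h2)
  have h5 : Real.goldenRatio + Real.goldenRatio⁻¹ ≤ 5 / 2 := by
    rw [Real.inv_goldenRatio, ← sub_eq_add_neg, Real.goldenRatio_sub_goldenConj]
    exact Real.sqrt_le_iff.2 (by norm_num)
  have h6 : e = k * (Real.goldenRatio + Real.goldenRatio⁻¹) - d := by
    rw [he, hd]; ring
  have h7 : 0 < Real.goldenRatio + Real.goldenRatio⁻¹ := by
    have := Real.goldenRatio_pos
    positivity
  have h8 : |e| ≤ 3 * |(k : ℝ)| := by
    calc |e| ≤ |(k : ℝ) * (Real.goldenRatio + Real.goldenRatio⁻¹)| + |d| := by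
          rw [h6]; exact abs_sub _ _
      _ = |(k : ℝ)| * (Real.goldenRatio + Real.goldenRatio⁻¹) + |d| := by
          rw [abs_mul, abs_of_pos h7]
      _ ≤ 3 * |(k : ℝ)| := by nlinarith
  nlinarith [abs_nonneg d]

theorem two_div_le_abs_sin_pi_mul_inv_goldenRatio {k : ℤ} (hk : k ≠ 0) :
    2 / (3 * |(k : ℝ)|) ≤ |Real.sin (π * (k * Real.goldenRatio⁻¹))| := by
  set x := (k : ℝ) * Real.goldenRatio⁻¹ with hx
  have h1 := one_div_le_abs_mul_inv_goldenRatio_sub hk (round x)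
  rw [← hx] at h1
  have h2 := abs_sub_round x
  have h3 : |π * (x - round x)| ≤ π / 2 := by
    rw [abs_mul, abs_of_pos Real.pi_pos]
    nlinarith [Real.pi_pos]
  have h4 := Real.mul_abs_le_abs_sin h3
  have h5 : |Real.sin (π * (x - round x))| = |Real.sin (π * x)| := by
    rw [show π * (x - round x) = π * x - round x * π by ring, Real.sin_sub_int_mul_pi, abs_mul,
      abs_zpow]
    simp
  rw [h5, abs_mul, abs_of_pos Real.pi_pos] at h4
  have h6 : 2 / π * (π * |x - round x|) = 2 * |x - round x| := by
    field_simp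
  have h7 : 2 / (3 * |(k : ℝ)|) = 2 * (1 / (3 * |(k : ℝ)|)) := by ring
  linarith

theorem abs_fib_succ_mul_inv_goldenRatio_sub_fib_le (n : ℕ) :
    |(Nat.fib (n + 1) : ℝ) * Real.goldenRatio⁻¹ - Nat.fib n| ≤ 1 / Nat.fib (n + 1) := by
  have hq : (0 : ℝ) < Nat.fib (n + 1) := by exact_mod_cast Nat.fib_pos.2 n.succ_pos
  have h1 := Real.goldenConj_mul_fib_succ_add_fib n
  have h2 := Real.goldenRatio_mul_fib_succ_add_fib n
  have h3 : (Nat.fib (n + 1) : ℝ) * Real.goldenRatio⁻¹ - Nat.fib n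
      = -Real.goldenConj ^ (n + 1) := by
    rw [Real.inv_goldenRatio, ← h1]; ring
  have h4 : |Real.goldenConj ^ (n + 1)| * Real.goldenRatio ^ (n + 1) = 1 := by
    rw [abs_pow, abs_of_neg Real.goldenConj_neg, ← Real.inv_goldenRatio, ← mul_pow,
      inv_mul_cancel₀ Real.goldenRatio_ne_zero, one_pow]
  have h5 : (Nat.fib (n + 1) : ℝ) ≤ Real.goldenRatio ^ (n + 1) := by
    rw [← h2]
    nlinarith [Real.one_lt_goldenRatio, (Nat.cast_nonneg (Nat.fib n) : (0 : ℝ) ≤ _)]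
  rw [h3, abs_neg, le_div_iff₀ hq]
  calc _ ≤ |Real.goldenConj ^ (n + 1)| * Real.goldenRatio ^ (n + 1) := by gcongr
    _ = 1 := h4

/-- Among `q` consecutive multiples of `φ⁻¹`, `q` a Fibonacci number, one is within `2 / q` of any
given `x` modulo `1`. Indeed `φ⁻¹` is within `1 / q ^ 2` of a reduced fraction with denominator `q`,
whose multiples run through all of `q⁻¹ ℤ / ℤ`. -/
theorem exists_abs_mul_inv_goldenRatio_sub_le (n : ℕ) (a : ℤ) (x : ℝ) :
    ∃ i p : ℤ, a ≤ i ∧ i < a + Nat.fib (n + 1) ∧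
      |(i : ℝ) * Real.goldenRatio⁻¹ - x - p| ≤ 2 / Nat.fib (n + 1) := by
  have hq0 : 0 < Nat.fib (n + 1) := Nat.fib_pos.2 n.succ_pos
  have h1 := abs_fib_succ_mul_inv_goldenRatio_sub_fib_le n
  have hco : IsCoprime (Nat.fib n : ℤ) (Nat.fib (n + 1) : ℤ) :=
    Nat.isCoprime_iff_coprime.2 (Nat.fib_coprime_fib_succ n)
  set q := Nat.fib (n + 1)
  set f := Nat.fib n
  set α := Real.goldenRatio⁻¹
  have hq : (0 : ℝ) < q := by exact_mod_cast hq0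
  set R : ℤ := round ((q : ℝ) * (x - a * α)) with hR
  have h2 := abs_sub_round ((q : ℝ) * (x - a * α))
  rw [← hR] at h2
  obtain ⟨s, t, hst⟩ := hco
  -- `u` solves `u * f ≡ R` modulo `q`
  set u : ℤ := (R * s) % q with hu
  have hu0 : 0 ≤ u := Int.emod_nonneg _ (by exact_mod_cast hq0.ne')
  have huq : u < q := Int.emod_lt_of_pos _ (by exact_mod_cast hq0)
  have huf : u * f = R + q * (-(R * t) - (R * s) / q * f) := by
    have h3 : u = R * s - q * (R * s / q) := by rw [hu, Int.emod_def]
    rw [h3]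
    linear_combination R * hst
  set p : ℤ := -(R * t) - (R * s) / q * f
  refine ⟨a + u, p, by linarith, by linarith, ?_⟩
  have hufR : (u : ℝ) * f = R + q * p := by exact_mod_cast huf
  have hu0R : (0 : ℝ) ≤ u := by exact_mod_cast hu0
  have huqR : (u : ℝ) ≤ q := by exact_mod_cast huq.le
  have key : q * (((a + u : ℤ) : ℝ) * α - x - p)
      = -(q * (x - a * α) - R) + u * (q * α - f) := by
    push_cast
    linear_combination hufR
  rw [le_div_iff₀ hq, mul_comm, ← abs_of_pos hq, ← abs_mul, key]
  have h4 : |(u : ℝ) * (q * α - f)| ≤ 1 := by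
    rw [abs_mul, abs_of_nonneg hu0R]
    calc (u : ℝ) * |q * α - f| ≤ q * (1 / q) := by gcongr
      _ = 1 := by field_simp
  calc _ ≤ |-(q * (x - a * α) - R)| + |(u : ℝ) * (q * α - f)| := abs_add_le _ _
    _ ≤ 1 / 2 + 1 := by rw [abs_neg]; gcongr
    _ ≤ 2 := by norm_num

theorem exists_fib_succ_le_lt_two_mul {x : ℝ} (hx : 1 ≤ x) :
    ∃ n : ℕ, (Nat.fib (n + 1) : ℝ) ≤ x ∧ x < 2 * Nat.fib (n + 1) := by
  have h1 : 1 ≤ ⌊x⌋₊ := Nat.le_floor (by exact_mod_cast hx)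
  obtain ⟨n, hn⟩ : ∃ n, Nat.greatestFib ⌊x⌋₊ = n + 1 :=
    Nat.exists_eq_succ_of_ne_zero (by
      have : 1 ≤ Nat.greatestFib ⌊x⌋₊ := Nat.le_greatestFib.2 (by simpa using h1)
      omega)
  refine ⟨n, ?_, ?_⟩
  · have h2 := Nat.fib_greatestFib_le ⌊x⌋₊
    rw [hn] at h2
    exact (Nat.cast_le.2 h2).trans (Nat.floor_le (by linarith))
  · have h2 := Nat.lt_fib_greatestFib_add_one ⌊x⌋₊
    rw [hn] at h2
    have h3 : Nat.fib (n + 1 + 1) ≤ 2 * Nat.fib (n + 1) := by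
      rw [Nat.fib_add_two]
      have := Nat.fib_le_fib_succ (n := n)
      omega
    have h4 : ⌊x⌋₊ + 1 ≤ 2 * Nat.fib (n + 1) := by omega
    calc x < ⌊x⌋₊ + 1 := Nat.lt_floor_add_one x
      _ ≤ _ := by exact_mod_cast h4

/-! ### Distances on the sphere in latitude and longitude -/

theorem dist_sq_spherePoint (φ θ φ' θ' : ℝ) :
    dist (spherePoint φ θ) (spherePoint φ' θ') ^ 2
      = (Real.sin φ - Real.sin φ') ^ 2 + (Real.cos φ - Real.cos φ') ^ 2
        + 4 * Real.cos φ * Real.cos φ' * Real.sin ((θ - θ') / 2) ^ 2 := by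
  rw [EuclideanSpace.dist_eq, Real.sq_sqrt (by positivity)]
  simp only [spherePoint, Fin.sum_univ_three, Real.dist_eq, sq_abs, Fin.isValue,
    Matrix.cons_val_zero, Matrix.cons_val_one, Matrix.cons_val]
  have h1 : Real.sin ((θ - θ') / 2) ^ 2 = (1 - Real.cos (θ - θ')) / 2 := by
    rw [Real.sin_sq_eq_half_sub]
    ring_nf
  rw [h1, Real.cos_sub]
  linear_combination (Real.cos φ) ^ 2 * Real.sin_sq_add_cos_sq θ
    + (Real.cos φ') ^ 2 * Real.sin_sq_add_cos_sq θ'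

theorem exists_spherePoint_eq {y : EuclideanSpace ℝ (Fin 3)} (hy : y ∈ unitSphere) :
    ∃ φ θ : ℝ, 0 ≤ Real.cos φ ∧ spherePoint φ θ = y := by
  have h : y 0 ^ 2 + y 1 ^ 2 + y 2 ^ 2 = 1 := by
    have h0 : ‖y‖ = 1 := by simpa using hy
    have h1 : ‖y‖ ^ 2 = 1 := by rw [h0]; norm_num
    rw [EuclideanSpace.norm_eq, Real.sq_sqrt (by positivity)] at h1
    simpa [Fin.sum_univ_three] using h1
  set ζ : ℂ := ⟨y 0, y 1⟩ with hζ
  have h2 : ‖ζ‖ = √(1 - y 2 ^ 2) := by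
    rw [Complex.norm_def, Complex.normSq_apply]
    congr 1
    simp only [hζ]
    linarith
  have h3 : Real.cos (Real.arcsin (y 2)) = ‖ζ‖ := by rw [Real.cos_arcsin, h2]
  refine ⟨Real.arcsin (y 2), Complex.arg ζ, by rw [h3]; positivity, ?_⟩
  have h5 : Real.sin (Real.arcsin (y 2)) = y 2 :=
    Real.sin_arcsin (by nlinarith [sq_nonneg (y 0), sq_nonneg (y 1)])
      (by nlinarith [sq_nonneg (y 0), sq_nonneg (y 1)])
  ext j
  fin_cases j
  · simp [spherePoint, h3, Complex.norm_mul_cos_arg, hζ]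
  · simp [spherePoint, h3, Complex.norm_mul_sin_arg, hζ]
  · simp [spherePoint, h5]

theorem cos_fibonacciLatitude_nonneg (N : ℕ) (i : ℤ) : 0 ≤ Real.cos (fibonacciLatitude N i) :=
  Real.cos_arcsin_nonneg _

/-- The points of the configuration keep a horizontal distance at least `(2 N + 1) ^ (-1 / 2)` from
the axis. -/
theorem one_div_le_cos_fibonacciLatitude_sq {N : ℕ} {i : ℤ}
    (hi : i ∈ Set.Icc (-(N : ℤ)) (N : ℤ)) :
    1 / (2 * (N : ℝ) + 1) ≤ Real.cos (fibonacciLatitude N i) ^ 2 := by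
  have h1 : (-(N : ℝ)) ≤ i := by exact_mod_cast hi.1
  have h2 : (i : ℝ) ≤ N := by exact_mod_cast hi.2
  have hN : (0 : ℝ) ≤ N := N.cast_nonneg
  rw [Real.cos_sq', sin_fibonacciLatitude hi, div_pow, div_le_iff₀ (by positivity), sub_mul,
    div_mul_eq_mul_div, le_sub_iff_add_le, ← le_sub_iff_add_le', div_le_iff₀ (by positivity)]
  nlinarith [mul_nonneg (sub_nonneg.2 h2) (by linarith : (0 : ℝ) ≤ N + i)]

/-! ### Separation -/

/-- The separation estimate for two points with heights `z`, `w` and horizontal radii `s ≤ r`, whose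
indices differ by `k` and with `t` the sine of half the difference of longitudes. If `r / 2 < s` and
the points are not nearly antipodal, the squared chord along the meridian is at least of order
`(k / (M * r)) ^ 2` and the longitudinal part at least of order `(r / k) ^ 2`. The geometric mean of
these is of order `1 / M` whatever `r` and `k` are. -/
theorem one_div_le_meridian_add_parallel {M k r s z w t : ℝ} (hM : 1 ≤ M) (hk : 1 ≤ k)
    (hs : 0 ≤ s) (hsr : s ≤ r) (hr : r ^ 2 + z ^ 2 = 1) (hw : s ^ 2 + w ^ 2 = 1)
    (hrM : 1 / M ≤ r ^ 2) (hzw : (z - w) ^ 2 = (2 * k / M) ^ 2) (ht : (2 / (3 * k)) ^ 2 ≤ t ^ 2) :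
    1 / (4 * M) ≤ (z - w) ^ 2 + (r - s) ^ 2 + 4 * r * s * t ^ 2 := by
  have hM0 : 0 < M := by linarith
  have hk0 : 0 < k := by linarith
  have hr2 : 0 < r ^ 2 := lt_of_lt_of_le (by positivity) hrM
  have hr0 : 0 < r := lt_of_le_of_ne (hs.trans hsr) (by rintro rfl; simp at hr2)
  have hM4 : 1 / (4 * M) = 1 / M / 4 := by field_simp
  have hM1 : 1 / M ≤ 1 := by rw [div_le_one hM0]; exact hM
  have hrs : 0 ≤ 4 * r * s * t ^ 2 := by positivity
  rcases le_or_gt s (r / 2) with h | h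
  · have h1 : (r / 2) ^ 2 ≤ (r - s) ^ 2 := pow_le_pow_left₀ (by positivity) (by linarith) 2
    linarith [sq_nonneg (z - w), (by ring : (r / 2) ^ 2 = r ^ 2 / 4)]
  set X := (z - w) ^ 2 + (r - s) ^ 2 with hX
  -- The chord to the point antipodal in the meridian circle; it is long unless `X` is large.
  have hX4 : X + ((z + w) ^ 2 + (r + s) ^ 2) = 4 := by rw [hX]; linarith
  rcases le_or_gt 2 X with h2 | h2
  · linarith
  -- Both points lie on the unit circle, so `(r - s) * (r + s) = -(z - w) * (z + w)`.
  have hXrs : X * (r + s) ^ 2 = (z - w) ^ 2 * ((z + w) ^ 2 + (r + s) ^ 2) := by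
    have : (r - s) * (r + s) = -((z - w) * (z + w)) := by linarith
    rw [hX]
    linear_combination ((r - s) * (r + s) - (z - w) * (z + w)) * this
  have hX0 : 0 ≤ X := by positivity
  have h3 : 2 * (2 * k / M) ^ 2 ≤ X * (4 * r ^ 2) := by
    calc 2 * (2 * k / M) ^ 2 ≤ X * (r + s) ^ 2 := by
          rw [hXrs, hzw, mul_comm]
          gcongr
          linarith
      _ ≤ X * (2 * r) ^ 2 := by
          gcongr
          linarith
      _ = X * (4 * r ^ 2) := by ring
  have hrs2 : r * (r / 2) ≤ r * s := by gcongr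
  have h4 : 2 * r ^ 2 * (2 / (3 * k)) ^ 2 ≤ 4 * r * s * t ^ 2 :=
    mul_le_mul (by linarith) ht (by positivity) (by positivity)
  generalize 4 * r * s * t ^ 2 = Y at *
  clear_value X
  have h5 : (4 / (3 * M)) ^ 2 ≤ X * Y := by
    have h6 : 2 * (2 * k / M) ^ 2 * (2 * r ^ 2 * (2 / (3 * k)) ^ 2)
        = (4 / (3 * M)) ^ 2 * (4 * r ^ 2) := by
      field_simp
      norm_num
    have h7 : (4 / (3 * M)) ^ 2 * (4 * r ^ 2) ≤ X * Y * (4 * r ^ 2) := by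
      rw [← h6]
      calc _ ≤ X * (4 * r ^ 2) * Y := by gcongr
        _ = _ := by ring
    exact le_of_mul_le_mul_right h7 (by positivity)
  have h8 : (4 / (3 * M)) ^ 2 ≤ (X + Y) ^ 2 := by
    have h9 : 0 ≤ X * Y := le_trans (by positivity) h5
    linarith [sq_nonneg (X - Y), (by ring : (X + Y) ^ 2 = 4 * (X * Y) + (X - Y) ^ 2)]
  have h9 := abs_le_of_sq_le_sq h8 (by positivity)
  have h10 : 4 / (3 * M) = 4 / 3 * (1 / M) := by field_simp
  have : 0 < 1 / M := by positivity
  linarith [le_of_abs_le h9]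

theorem one_div_le_dist_sq_fibonacci {N : ℕ} {i j : ℤ} (hi : i ∈ Set.Icc (-(N : ℤ)) (N : ℤ))
    (hj : j ∈ Set.Icc (-(N : ℤ)) (N : ℤ)) (hij : i ≠ j) :
    1 / (4 * (2 * (N : ℝ) + 1)) ≤
      dist (spherePoint (fibonacciLatitude N i) (fibonacciLongitude i))
        (spherePoint (fibonacciLatitude N j) (fibonacciLongitude j)) ^ 2 := by
  wlog h : Real.cos (fibonacciLatitude N j) ≤ Real.cos (fibonacciLatitude N i) generalizing i j
  · rw [dist_comm]
    exact this hj hi hij.symm (le_of_not_ge h)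
  have hk : i - j ≠ 0 := sub_ne_zero.2 hij
  have hk1 : (1 : ℝ) ≤ |((i - j : ℤ) : ℝ)| := by exact_mod_cast Int.one_le_abs hk
  rw [dist_sq_spherePoint]
  refine one_div_le_meridian_add_parallel (k := |((i - j : ℤ) : ℝ)|) ?_ hk1
    (cos_fibonacciLatitude_nonneg N j) h (Real.cos_sq_add_sin_sq _) (Real.cos_sq_add_sin_sq _)
    (one_div_le_cos_fibonacciLatitude_sq hi) ?_ ?_
  · linarith [(N.cast_nonneg : (0 : ℝ) ≤ N)]
  · rw [sin_fibonacciLatitude hi, sin_fibonacciLatitude hj, ← sub_div, div_pow, div_pow, mul_pow,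
      sq_abs]
    push_cast
    ring
  · have h1 := two_div_le_abs_sin_pi_mul_inv_goldenRatio hk
    have h2 : (fibonacciLongitude i - fibonacciLongitude j) / 2
        = π * (((i - j : ℤ) : ℝ) * Real.goldenRatio⁻¹) := by
      simp only [fibonacciLongitude]
      push_cast
      ring
    rw [h2, ← sq_abs (Real.sin _)]
    gcongr

theorem le_separation_fibonacciConfiguration {N : ℕ} (hN : (fibonacciConfiguration N).Nontrivial) :
    1 / 2 / √(2 * (N : ℝ) + 1) ≤ separation (fibonacciConfiguration N) := by
  refine hN.le_infsep ?_
  rintro _ ⟨i, hi, rfl⟩ _ ⟨j, hj, rfl⟩ hne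
  have h := one_div_le_dist_sq_fibonacci hi hj (fun h => hne (by rw [h]))
  refine le_of_sq_le_sq ?_ dist_nonneg
  refine le_trans (le_of_eq ?_) h
  rw [div_pow, Real.sq_sqrt (by positivity)]
  field_simp
  norm_num

/-- Near a pole the longitudes do not matter: two points of the same polar cap are close. -/
theorem dist_le_of_cos_le {M φ θ φ' θ' A : ℝ}
    (hs : |Real.sin φ - Real.sin φ'| ≤ A / √M) (hc : 0 ≤ Real.cos φ) (hc' : 0 ≤ Real.cos φ')
    (h : Real.cos φ ≤ A / √M) (h' : Real.cos φ' ≤ A / √M) :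
    dist (spherePoint φ θ) (spherePoint φ' θ') ≤ 3 * A / √M := by
  have hA : 0 ≤ A / √M := hc.trans h
  refine le_of_sq_le_sq ?_ (by rw [mul_div_assoc]; positivity)
  rw [dist_sq_spherePoint, mul_div_assoc, mul_pow]
  set B := A / √M
  have h1 : (Real.sin φ - Real.sin φ') ^ 2 ≤ B ^ 2 := sq_le_sq' (neg_le_of_abs_le hs)
    (le_of_abs_le hs)
  have h2 : Real.cos φ * Real.cos φ' ≤ B ^ 2 := by rw [sq]; gcongr
  have h3 := Real.sin_sq_le_one ((θ - θ') / 2)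
  have h4 : (Real.cos φ - Real.cos φ') ^ 2 ≤ B ^ 2 := by apply sq_le_sq' <;> linarith
  nlinarith [mul_nonneg (mul_nonneg hc hc') (sub_nonneg.2 h3), sq_nonneg B]

theorem cos_fibonacciLatitude_le {N : ℕ} {i : ℤ} (hi : i ∈ Set.Icc (-(N : ℤ)) (N : ℤ)) {A : ℝ}
    (hA : 0 ≤ A) (h : (2 * (N : ℝ) + 1) ^ 2 - 4 * (i : ℝ) ^ 2 ≤ A ^ 2 * (2 * (N : ℝ) + 1)) :
    Real.cos (fibonacciLatitude N i) ≤ A / √(2 * (N : ℝ) + 1) := by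
  refine le_of_sq_le_sq ?_ (by positivity)
  rw [Real.cos_sq', sin_fibonacciLatitude hi, div_pow, div_pow, Real.sq_sqrt (by positivity),
    sub_le_iff_le_add, div_add_div _ _ (by positivity) (by positivity), le_div_iff₀ (by positivity)]
  nlinarith [mul_le_mul_of_nonneg_right h (by positivity : 0 ≤ 2 * (N : ℝ) + 1)]

theorem one_div_le_one_div_sqrt {M : ℝ} (hM : 1 ≤ M) : 1 / M ≤ 1 / √M := by
  have h : √M ≤ M := Real.sqrt_le_iff.2 ⟨by linarith, by nlinarith⟩
  have : 0 < √M := Real.sqrt_pos.2 (by linarith)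
  gcongr

/-- The two points next to the north pole both have horizontal radius `O((2 N + 1) ^ (-1 / 2))`,
so the distance between them is of that order. -/
theorem separation_fibonacciConfiguration_le {N : ℕ} (hN : 1 ≤ N) :
    separation (fibonacciConfiguration N) ≤ 9 / √(2 * (N : ℝ) + 1) := by
  have hN1 : (1 : ℝ) ≤ N := by exact_mod_cast hN
  have hi : (N : ℤ) ∈ Set.Icc (-(N : ℤ)) (N : ℤ) := ⟨by omega, le_rfl⟩
  have hj : (N - 1 : ℤ) ∈ Set.Icc (-(N : ℤ)) (N : ℤ) := ⟨by omega, by omega⟩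
  have hs : Real.sin (fibonacciLatitude N N) - Real.sin (fibonacciLatitude N (N - 1))
      = 2 * (1 / (2 * (N : ℝ) + 1)) := by
    rw [sin_fibonacciLatitude hi, sin_fibonacciLatitude hj]
    push_cast
    ring
  have hs0 : (0 : ℝ) < 2 * (1 / (2 * (N : ℝ) + 1)) := by positivity
  refine (Set.infsep_le_dist_of_mem (Set.mem_image_of_mem _ hi) (Set.mem_image_of_mem _ hj)
    ?_).trans ((dist_le_of_cos_le (M := 2 * (N : ℝ) + 1) (A := 3) ?_
      (cos_fibonacciLatitude_nonneg _ _) (cos_fibonacciLatitude_nonneg _ _) ?_ ?_).trans (by norm_num))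
  · intro h
    have h2 := congrArg (fun v : EuclideanSpace ℝ (Fin 3) => v 2) h
    simp only [spherePoint, Matrix.cons_val] at h2
    rw [h2, sub_self] at hs
    linarith
  · rw [hs, abs_of_pos hs0]
    have h1 := one_div_le_one_div_sqrt (M := 2 * (N : ℝ) + 1) (by linarith)
    have h2 : 0 ≤ 1 / √(2 * (N : ℝ) + 1) := by positivity
    rw [← mul_one_div 3]
    linarith
  · refine cos_fibonacciLatitude_le hi (by norm_num) ?_
    push_cast
    nlinarith
  · refine cos_fibonacciLatitude_le hj (by norm_num) ?_
    push_cast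
    nlinarith

/-! ### Covering -/

theorem exists_fibonacci_dist_le_of_cos_le {N : ℕ} {φ θ : ℝ} (hc : 0 ≤ Real.cos φ)
    (h : Real.cos φ ≤ 1 / √(2 * (N : ℝ) + 1)) :
    ∃ i ∈ Set.Icc (-(N : ℤ)) (N : ℤ), dist (spherePoint φ θ)
      (spherePoint (fibonacciLatitude N i) (fibonacciLongitude i)) ≤ 6 / √(2 * (N : ℝ) + 1) := by
  have hN0 : (0 : ℝ) ≤ N := N.cast_nonneg
  have hsq : Real.cos φ ^ 2 ≤ 1 / (2 * (N : ℝ) + 1) := by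
    calc Real.cos φ ^ 2 ≤ (1 / √(2 * (N : ℝ) + 1)) ^ 2 := by gcongr
      _ = _ := by rw [div_pow, Real.sq_sqrt (by positivity), one_pow]
  have hsc := Real.sin_sq_add_cos_sq φ
  have h1 := one_div_le_one_div_sqrt (M := 2 * (N : ℝ) + 1) (by linarith)
  have h2 : 0 ≤ 1 / √(2 * (N : ℝ) + 1) := by positivity
  have key : ∀ i ∈ Set.Icc (-(N : ℤ)) (N : ℤ), (i : ℝ) ^ 2 = (N : ℝ) ^ 2 →
      |Real.sin φ - Real.sin (fibonacciLatitude N i)| ≤ 1 / (2 * (N : ℝ) + 1) →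
      dist (spherePoint φ θ) (spherePoint (fibonacciLatitude N i) (fibonacciLongitude i))
        ≤ 6 / √(2 * (N : ℝ) + 1) := by
    intro i hi hiN hd
    refine (dist_le_of_cos_le (M := 2 * (N : ℝ) + 1) (A := 2) ?_ hc
      (cos_fibonacciLatitude_nonneg _ _) ?_ ?_).trans (by norm_num)
    · rw [← mul_one_div 2]; linarith
    · rw [← mul_one_div 2]; linarith
    · refine cos_fibonacciLatitude_le hi (by norm_num) ?_
      rw [hiN]
      nlinarith
  have hz : 2 * (N : ℝ) / (2 * (N : ℝ) + 1) = 1 - 1 / (2 * (N : ℝ) + 1) := by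
    field_simp
    ring
  rcases le_total 0 (Real.sin φ) with hs | hs
  · have hi : (N : ℤ) ∈ Set.Icc (-(N : ℤ)) (N : ℤ) := ⟨by omega, le_rfl⟩
    refine ⟨N, hi, key _ hi (by push_cast; ring) ?_⟩
    rw [sin_fibonacciLatitude hi, Int.cast_natCast, hz, abs_le]
    constructor <;> nlinarith [Real.sin_le_one φ]
  · have hi : (-N : ℤ) ∈ Set.Icc (-(N : ℤ)) (N : ℤ) := ⟨le_rfl, by omega⟩
    refine ⟨-N, hi, key _ hi (by push_cast; ring) ?_⟩
    rw [sin_fibonacciLatitude hi, Int.cast_neg, Int.cast_natCast, mul_neg, neg_div, hz, abs_le]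
    constructor <;> nlinarith [Real.neg_one_le_sin φ]

/-- A window of `q` consecutive integers near `t` that stays inside `[-N, N]`: it is taken on the
side of `t` towards `0`. -/
theorem exists_window {N q : ℕ} {t : ℝ} (hq : 1 ≤ q) (hqN : q ≤ N + 1) (ht : |t| ≤ N + 1 / 2) :
    ∃ a : ℤ, -(N : ℤ) ≤ a ∧ a + q ≤ N + 1 ∧ ∀ i : ℤ, a ≤ i → i < a + q → |(i : ℝ) - t| ≤ q := by
  obtain ⟨ht1, ht2⟩ := abs_le.1 ht
  have hqR : (1 : ℝ) ≤ q := by exact_mod_cast hq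
  rcases le_total 0 t with h | h
  · have h0 : 0 ≤ ⌊t⌋ := Int.floor_nonneg.2 h
    have h1 : ⌊t⌋ < N + 1 := by
      rw [Int.floor_lt]
      push_cast
      linarith
    refine ⟨⌊t⌋ - q + 1, by omega, by omega, fun i hi1 hi2 => ?_⟩
    have h3 : ((⌊t⌋ - q + 1 : ℤ) : ℝ) ≤ i := by exact_mod_cast hi1
    have h4 : (i : ℝ) ≤ (⌊t⌋ : ℝ) := by exact_mod_cast (by omega : i ≤ ⌊t⌋)
    push_cast at h3
    rw [abs_le]
    constructor <;> linarith [Int.floor_le t, Int.lt_floor_add_one t]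
  · have h0 : ⌈t⌉ ≤ 0 := Int.ceil_le.2 (by simpa using h)
    have h1 : -(N : ℤ) - 1 < ⌈t⌉ := by
      rw [Int.lt_ceil]
      push_cast
      linarith
    refine ⟨⌈t⌉, by omega, by omega, fun i hi1 hi2 => ?_⟩
    have h3 : ((⌈t⌉ : ℤ) : ℝ) ≤ i := by exact_mod_cast hi1
    have h4 : (i : ℝ) ≤ (⌈t⌉ : ℝ) + q - 1 := by exact_mod_cast (by omega : i ≤ ⌈t⌉ + q - 1)
    rw [abs_le]
    constructor <;> linarith [Int.le_ceil t, Int.ceil_lt_add_one t]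

/-- Away from the poles, take a window of `q` consecutive indices with heights near that of the
given point, where the Fibonacci number `q` is comparable to `cos φ * √(2 N + 1)`. This choice
balances the displacement along the meridian, of order `q / ((2 N + 1) * cos φ)`, and the one
along the parallel, of order `cos φ / q`. -/
theorem exists_fibonacci_dist_le_of_le_cos {N : ℕ} {φ θ : ℝ}
    (h : 1 / √(2 * (N : ℝ) + 1) ≤ Real.cos φ) :
    ∃ i ∈ Set.Icc (-(N : ℤ)) (N : ℤ), dist (spherePoint φ θ)
      (spherePoint (fibonacciLatitude N i) (fibonacciLongitude i)) ≤ 72 / √(2 * (N : ℝ) + 1) := by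
  have hN0 : (0 : ℝ) ≤ N := N.cast_nonneg
  obtain ⟨S, hS⟩ : ∃ S, S = √(2 * (N : ℝ) + 1) := ⟨_, rfl⟩
  have hSS : S ^ 2 = 2 * (N : ℝ) + 1 := by rw [hS, Real.sq_sqrt (by positivity)]
  have hS0 : 0 < S := by rw [hS]; positivity
  rw [← hS] at h ⊢
  set r := Real.cos φ with hr
  have hr0 : 0 < r := lt_of_lt_of_le (by positivity) h
  have hx : 1 ≤ r * S := by rwa [div_le_iff₀ hS0] at h
  obtain ⟨n, hn1, hn2⟩ := exists_fib_succ_le_lt_two_mul hx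
  have hdense := exists_abs_mul_inv_goldenRatio_sub_le n
  have hq1 : 1 ≤ Nat.fib (n + 1) := Nat.fib_pos.2 n.succ_pos
  generalize Nat.fib (n + 1) = q at *
  have hq0 : (0 : ℝ) < q := by exact_mod_cast hq1
  have hrS : r * S ≤ S := by nlinarith [Real.cos_le_one φ]
  -- `q ≤ S ≤ (S ^ 2 + 1) / 2 = N + 1`
  have hqN : q ≤ N + 1 := by
    have : (q : ℝ) ≤ N + 1 := by nlinarith [sq_nonneg (S - 1)]
    exact_mod_cast this
  set t : ℝ := (2 * N + 1) * Real.sin φ / 2 with ht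
  have htN : |t| ≤ N + 1 / 2 := by
    rw [ht, abs_le]
    constructor <;> nlinarith [Real.sin_le_one φ, Real.neg_one_le_sin φ]
  obtain ⟨a, ha1, ha2, ha⟩ := exists_window hq1 hqN htN
  obtain ⟨i, p, hi1, hi2, hip⟩ := hdense a (θ / (2 * π))
  have hi : i ∈ Set.Icc (-(N : ℤ)) (N : ℤ) := ⟨by omega, by omega⟩
  have hit := ha i hi1 hi2
  refine ⟨i, hi, le_of_sq_le_sq ?_ (by positivity)⟩
  have hz : |Real.sin φ - Real.sin (fibonacciLatitude N i)| ≤ 2 * (r / S) := by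
    have h1 : Real.sin φ - Real.sin (fibonacciLatitude N i) = -(2 * (i - t) / S ^ 2) := by
      rw [sin_fibonacciLatitude hi, hSS, ht]
      field_simp
      ring
    rw [h1, abs_neg, abs_div, abs_mul, abs_two, abs_of_pos (by positivity : 0 < S ^ 2),
      div_le_iff₀ (by positivity)]
    have h2 : 2 * (r / S) * S ^ 2 = 2 * (r * S) := by field_simp
    linarith
  rw [dist_sq_spherePoint, ← hr]
  set w := Real.sin (fibonacciLatitude N i)
  set s := Real.cos (fibonacciLatitude N i) with hs
  have hs0 : 0 ≤ s := cos_fibonacciLatitude_nonneg N i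
  have hrs : |r - s| ≤ 4 * (1 / S) := by
    have h1 : |r - s| * (r + s) = |Real.sin φ - w| * |Real.sin φ + w| := by
      rw [← abs_mul, ← abs_of_nonneg (by positivity : 0 ≤ r + s), ← abs_mul, ← abs_neg]
      congr 1
      linear_combination Real.sin_sq_add_cos_sq (fibonacciLatitude N i) - Real.sin_sq_add_cos_sq φ
    have h2 : |Real.sin φ + w| ≤ 2 := by
      rw [abs_le]
      constructor <;> linarith [Real.sin_le_one φ, Real.neg_one_le_sin φ,
        Real.sin_le_one (fibonacciLatitude N i), Real.neg_one_le_sin (fibonacciLatitude N i)]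
    have h3 : |r - s| * r ≤ 4 * (1 / S) * r := by
      calc |r - s| * r ≤ |r - s| * (r + s) := by gcongr; linarith
        _ ≤ 2 * (r / S) * 2 := by rw [h1]; gcongr
        _ = 4 * (1 / S) * r := by ring
    exact le_of_mul_le_mul_right h3 hr0
  have hs5 : s ≤ 5 * r := by linarith [(abs_le.1 hrs).1]
  have hsin : Real.sin ((θ - fibonacciLongitude i) / 2) ^ 2 ≤ (16 / (r * S)) ^ 2 := by
    have h1 : (θ - fibonacciLongitude i) / 2
        = -(π * (i * Real.goldenRatio⁻¹ - θ / (2 * π) - p)) - p * π := by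
      rw [fibonacciLongitude]
      field_simp
      ring
    rw [h1, Real.sin_sub_int_mul_pi, mul_pow, ← zpow_natCast, ← zpow_mul, mul_comm,
      Even.neg_one_zpow (by simp), mul_one, Real.sin_neg, neg_sq, ← sq_abs]
    gcongr
    calc |Real.sin (π * (i * Real.goldenRatio⁻¹ - θ / (2 * π) - p))|
        ≤ |π * (i * Real.goldenRatio⁻¹ - θ / (2 * π) - p)| := Real.abs_sin_le_abs
      _ ≤ 4 * (2 / q) := by
          rw [abs_mul, abs_of_pos Real.pi_pos]
          gcongr
          exact Real.pi_le_four
      _ ≤ 16 / (r * S) := by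
          rw [← mul_div_assoc, div_le_div_iff₀ hq0 (by positivity)]
          linarith
  -- The three parts of the squared distance are at most `4`, `16` and `5120` times `1 / S ^ 2`,
  -- and `4 + 16 + 5120 ≤ 72 ^ 2`.
  have e1 : (Real.sin φ - w) ^ 2 ≤ (2 * (1 / S)) ^ 2 := by
    rw [← sq_abs]
    refine pow_le_pow_left₀ (abs_nonneg _) (hz.trans ?_) 2
    gcongr
    exact Real.cos_le_one φ
  have e2 : (r - s) ^ 2 ≤ (4 * (1 / S)) ^ 2 := by
    rw [← sq_abs]
    exact pow_le_pow_left₀ (abs_nonneg _) hrs 2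
  have e3 : 4 * r * s * Real.sin ((θ - fibonacciLongitude i) / 2) ^ 2
      ≤ 4 * r * (5 * r) * (16 / (r * S)) ^ 2 := by gcongr
  have e4 : 4 * r * (5 * r) * (16 / (r * S)) ^ 2 = 5120 * (1 / S) ^ 2 := by
    field_simp
    norm_num
  have e5 : (72 / S) ^ 2 = 5184 * (1 / S) ^ 2 := by ring
  nlinarith [sq_nonneg (1 / S)]

theorem infDist_fibonacciConfiguration_le (N : ℕ) {y : EuclideanSpace ℝ (Fin 3)}
    (hy : y ∈ unitSphere) :
    Metric.infDist y (fibonacciConfiguration N) ≤ 72 / √(2 * (N : ℝ) + 1) := by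
  obtain ⟨φ, θ, hc, rfl⟩ := exists_spherePoint_eq hy
  rcases le_total (Real.cos φ) (1 / √(2 * (N : ℝ) + 1)) with h | h
  · obtain ⟨i, hi, hd⟩ := exists_fibonacci_dist_le_of_cos_le (θ := θ) hc h
    refine (Metric.infDist_le_dist_of_mem (Set.mem_image_of_mem _ hi)).trans (hd.trans ?_)
    gcongr
    norm_num
  · obtain ⟨i, hi, hd⟩ := exists_fibonacci_dist_le_of_le_cos (θ := θ) h
    exact (Metric.infDist_le_dist_of_mem (Set.mem_image_of_mem _ hi)).trans hd

theorem coveringRadius_fibonacciConfiguration_le (N : ℕ) :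
    coveringRadius (fibonacciConfiguration N) ≤ 72 / √(2 * (N : ℝ) + 1) :=
  haveI : Nonempty unitSphere := ⟨⟨_, spherePoint_mem_unitSphere 0 0⟩⟩
  ciSup_le fun y => infDist_fibonacciConfiguration_le N y.2

/-- The north pole realizes the lower bound: its distance to the configuration is at least the
least horizontal radius of a point of the configuration. -/
theorem le_coveringRadius_fibonacciConfiguration (N : ℕ) :
    1 / 2 / √(2 * (N : ℝ) + 1) ≤ coveringRadius (fibonacciConfiguration N) := by
  have hbdd : BddAbove (Set.range fun y : unitSphere =>
      Metric.infDist (y : EuclideanSpace ℝ (Fin 3)) (fibonacciConfiguration N)) :=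
    ⟨_, Set.forall_mem_range.2 fun y => infDist_fibonacciConfiguration_le N y.2⟩
  refine le_trans ?_ (le_ciSup hbdd ⟨_, spherePoint_mem_unitSphere (π / 2) 0⟩)
  have hne : (fibonacciConfiguration N).Nonempty :=
    ⟨_, Set.mem_image_of_mem _ (show (0 : ℤ) ∈ Set.Icc (-(N : ℤ)) (N : ℤ) by simp)⟩
  refine (Metric.le_infDist hne).2 ?_
  rintro _ ⟨i, hi, rfl⟩
  refine le_of_sq_le_sq ?_ dist_nonneg
  have h1 := one_div_le_cos_fibonacciLatitude_sq hi
  have h2 : (1 / 2 / √(2 * (N : ℝ) + 1)) ^ 2 = 1 / (2 * (N : ℝ) + 1) / 4 := by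
    rw [div_pow, Real.sq_sqrt (by positivity)]
    ring
  rw [dist_sq_spherePoint, Real.cos_pi_div_two, h2]
  have h3 : 0 ≤ 1 / (2 * (N : ℝ) + 1) := by positivity
  nlinarith [sq_nonneg (Real.sin (π / 2) - Real.sin (fibonacciLatitude N i))]

theorem mainTheorem3 :
    IsQuasiUniform fibonacciConfiguration ∧
    ∃ c C : ℝ, 0 < c ∧ 0 < C ∧ ∀ N : ℕ, 1 ≤ N →
      c / √(2 * (N : ℝ) + 1) ≤ separation (fibonacciConfiguration N) ∧
      separation (fibonacciConfiguration N) ≤ C / √(2 * (N : ℝ) + 1) ∧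
      c / √(2 * (N : ℝ) + 1) ≤ coveringRadius (fibonacciConfiguration N) ∧
      coveringRadius (fibonacciConfiguration N) ≤ C / √(2 * (N : ℝ) + 1) := by
  -- For `N = 0` the configuration is a single point, which is not `Nontrivial`.
  refine ⟨⟨72 / (1 / 2), fun N hN => ?_⟩, 1 / 2, 72, by norm_num, by norm_num, fun N hN =>
    ⟨?_, ?_, le_coveringRadius_fibonacciConfiguration N,
      coveringRadius_fibonacciConfiguration_le N⟩⟩
  · have hM : 0 < √(2 * (N : ℝ) + 1) := by positivity
    calc meshRatio (fibonacciConfiguration N)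
        ≤ (72 / √(2 * (N : ℝ) + 1)) / (1 / 2 / √(2 * (N : ℝ) + 1)) :=
          div_le_div₀ (by positivity) (coveringRadius_fibonacciConfiguration_le N) (by positivity)
            (le_separation_fibonacciConfiguration hN)
      _ = 72 / (1 / 2) := by field_simp
  · refine le_separation_fibonacciConfiguration ?_
    refine (Set.one_lt_ncard_iff_nontrivial_and_finite.1 ?_).1
    rw [ncard_fibonacciConfiguration]
    omega
  · refine (separation_fibonacciConfiguration_le hN).trans ?_
    gcongr
    norm_num
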